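/- Let $R$ denote either the max-times algebra ($\mathbb{R}_+=[0,\infty)$ with $a+b:=\max(a,b)$ and the usual product) or the usual nonnegative algebra ($\mathbb{R}_+$ with the usual operations); all matrix operations below are over $R$, and vectors and matrices are compared entrywise. Let $A\in\mathbb{R}_+^{n\times n}$ be in Frobenius normal form with classes $N_1,\dots,N_s$: the $N_j$ are consecutive nonempty blocks of $\{1,\dots,n\}$, $A_{N_iN_j}=0$ for $i<j$, and each diagonal block $A_{jj}:=A_{N_jN_j}$ is irreducible, i.e. its digraph (with an arc $(k,l)$ whenever $a_{kl}>0$) is strongly connected; every $1\times1$ block counts as irreducible. An index $i$ accesses $k$ if $i=k$ or there is a path from $i$ to $k$ in the digraph of $A$. Let $b\in\mathbb{R}_+^n$ and $\lambda\ge 0$, where $\lambda>0$ unless $b=0$. Write $A_\lambda:=A/\lambda$ and $b_\lambda:=b/\lambda$ (if $\lambda=0$, so that $b=0$, put $A_\lambda:=0$ and $b_\lambda:=0$). Let $J$ be the set of those $j$ for which some index of $N_j$ accesses some index of $\operatorname{supp}(b)=\{k: b_k\neq0\}$. An eigenvalue of a square matrix $B$ over $R$ is a $\mu\in\mathbb{R}_+$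 such that $Bv=\mu v$ for some nonzero vector $v$ with entries in $\mathbb{R}_+$. Let $\rho_j$ be the largest eigenvalue of $A_{jj}$, and $\overline\rho:=\max_{j\in J}\rho_j$, with $\max\emptyset:=0$. The Kleene star $B^*:=\sup_k(I+B+\dots+B^{k-1})$ and $B^*c:=\sup_k(c+Bc+\dots+B^{k-1}c)$ are said to converge if these entrywise suprema are finite. In each of the two algebras the following are equivalent: 1. The system $\lambda x=Ax+b$ has a solution $x\in\mathbb{R}_+^n$. 2. The system $\lambda x=Ax+b$ has a least solution. 3. $x^0:=A_\lambda^*b_\lambda$ converges. 4. For every $j\in J$, $(A_{jj}/\lambda)^*$ converges. 5. $\overline\rho\le\lambda$ (max-times algebra); $b=0$ or $\overline\rho<\lambda$ (nonnegative algebra). If these conditions hold, then (a) $x^0$ is the least solution of $\lambda x=Ax+b$; all components of $x^0$ with index in $N_i$ are positive when $i\in J$, and $x^0_{N_i}=0$ when $i\notin J$; and $x^0$ is the unique solution if and only if $\lambda$ is not an eigenvalue of $A$. (b) Every solution $x$ of $\lambda x=Ax+b$ can be expressed as $x=x^0+v$ with $v\in\mathbb{R}_+^n$, $Av=\lambda v$.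 -/

import Mathlib

open scoped NNReal Matrix

/-- Max-times algebra: the nonnegative reals with their usual order and multiplication,
and with the maximum as addition. -/
def MaxTimes : Type := ℝ≥0

namespace MaxTimes

noncomputable instance : ConditionallyCompleteLinearOrderBot MaxTimes :=
  inferInstanceAs (ConditionallyCompleteLinearOrderBot ℝ≥0)

noncomputable instance : CommGroupWithZero MaxTimes :=
  inferInstanceAs (CommGroupWithZero ℝ≥0)

noncomputable instance : Add MaxTimes := ⟨fun x y => max x y⟩

/-- The max-times algebra is a semifield; its zero, one, product and inverse are those of the
nonnegative reals. -/
noncomputable instance : Semifield MaxTimes :=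
  { (inferInstance : CommGroupWithZero MaxTimes) with
    add := fun x y => x + y
    add_assoc := fun x y z => max_assoc x y z
    add_comm := fun x y => max_comm x y
    zero_add := fun x => max_eq_right (bot_le (a := x))
    add_zero := fun x => max_eq_left (bot_le (a := x))
    left_distrib := fun x y z => mul_max_of_nonneg (R := ℝ≥0) y z zero_le
    right_distrib := fun x y z => max_mul_of_nonneg (R := ℝ≥0) x y zero_le
    nsmul := nsmulRec
    nnqsmul := _
    nnqsmul_def := fun _ _ => rfl }

theorem add_def (x y : MaxTimes) : x + y = max x y := rfl

theorem bot_eq_zero : (⊥ : MaxTimes) = 0 := rfl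

end MaxTimes

/-! The definitions below are used for `R = MaxTimes` and for `R = ℝ≥0`. All matrix operations are
those of the semiring `R`; vectors and matrices are compared entrywise. -/

section Defs

variable {R : Type*} [Semifield R] [ConditionallyCompleteLinearOrderBot R]
variable {ι : Type*} [Fintype ι] [DecidableEq ι]

/-- `i` accesses `j`: there is a path, possibly of length zero, from `i` to `j` in the digraph
with an arc `(k, l)` whenever `0 < A k l`. -/
def Accesses {R ι : Type*} [Zero R] [LT R] (A : Matrix ι ι R) (i j : ι) : Prop :=
  Relation.ReflTransGen (fun k l => 0 < A k l) i j

/-- Irreducibility: the associated digraph is strongly connected. Paths of length zero count,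
so that every `1 × 1` matrix is irreducible. -/
def IsIrred {R ι : Type*} [Zero R] [LT R] (A : Matrix ι ι R) : Prop :=
  ∀ i j, Accesses A i j

/-- `A` is in Frobenius normal form with `s` classes `N_j = {i | cls i = j}`: the classes are
nonempty sets of consecutive indices in increasing order, `A` is block lower triangular, and the
diagonal blocks are irreducible. -/
structure IsFNF {R : Type*} [Zero R] [LT R] {n s : ℕ}
    (A : Matrix (Fin n) (Fin n) R) (cls : Fin n → Fin s) : Prop where
  monotone : Monotone cls
  surjective : Function.Surjective cls
  lower : ∀ i j, cls i < cls j → A i j = 0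
  irred : ∀ j, IsIrred (A.toSquareBlock cls j)

open Classical in
/-- The set `J` of the classes that access the support of `b`. -/
noncomputable def accessClasses {R : Type*} [Zero R] [LT R] {n s : ℕ}
    (A : Matrix (Fin n) (Fin n) R) (cls : Fin n → Fin s) (b : Fin n → R) : Finset (Fin s) :=
  Finset.univ.filter fun j => ∃ i k, cls i = j ∧ b k ≠ 0 ∧ Accesses A i k

/-- `x` solves `λ x = A x + b`. -/
def IsSolution (A : Matrix ι ι R) (b : ι → R) (lam : R) (x : ι → R) : Prop :=
  lam • x = A *ᵥ x + b

/-- `lam` is an eigenvalue of `A` in the algebra `R` (eigenvectors have entries in `R`). -/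
def IsEigenvalue (A : Matrix ι ι R) (lam : R) : Prop :=
  ∃ v : ι → R, v ≠ 0 ∧ A *ᵥ v = lam • v

/-- The Perron root: the largest eigenvalue in the algebra `R`. -/
noncomputable def perronRoot (A : Matrix ι ι R) : R :=
  sSup {lam | IsEigenvalue A lam}

/-- The Kleene star `A* = sup_k (I + A + ⋯ + A^(k-1))` converges: entrywise suprema exist
in `R`. -/
def StarConverges (A : Matrix ι ι R) : Prop :=
  ∃ S : Matrix ι ι R, ∀ i j,
    IsLUB (Set.range fun k : ℕ => (∑ l ∈ Finset.range k, A ^ l) i j) (S i j)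

/-- `x = A* b`, that is, `x = sup_k (b + A b + ⋯ + A^(k-1) b)` in `R^n`. -/
def IsStarVec (A : Matrix ι ι R) (b x : ι → R) : Prop :=
  IsLUB (Set.range fun k : ℕ => ∑ l ∈ Finset.range k, (A ^ l) *ᵥ b) x

/-- The largest Perron root `max_{j ∈ J} ρ(A_jj)` over the classes that access the support of `b`;
the maximum of the empty set is the least element `0`. -/
noncomputable def rhoBar {n s : ℕ} (A : Matrix (Fin n) (Fin n) R) (cls : Fin n → Fin s)
    (b : Fin n → R) : R :=
  (accessClasses A cls b).sup fun j => perronRoot (A.toSquareBlock cls j)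

end Defs

set_option linter.unusedSectionVars false

namespace Matrix

open Filter Topology

variable {R : Type*} [Semifield R] [ConditionallyCompleteLinearOrderBot R]
  [CanonicallyOrderedAdd R] [IsOrderedRing R]
variable {ι : Type*} [Fintype ι]

/-! Both algebras are conditionally complete, canonically ordered semifields with continuous
operations, and almost everything is proved at that level, without subtraction. After division by
`lam`, solutions are the fixed points of `x ↦ C x + c`. The partial sums of `C* c` increase and stay
below every supersolution; when bounded, their supremum is a fixed point by continuity, hence the
least solution. Iterating from an arbitrary solution `x` gives `x = C^k x + (partial sum)`, where
`C^k x` decreases to some `v` with `C v = v`; this is the decomposition `x = x₀ + v`. If `lam = 0`,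
then `b = 0`, and the convention `0⁻¹ = 0` gives `C = 0` and `x₀ = 0`.

Convergence is then reduced to diagonal blocks. Positivity of `x₀` on a class bounds the star of its
block (`starConverges_toSquareBlock`); conversely, convergent block stars yield a supersolution,
built class by class (`exists_supersolution`). An irreducible block has a positive eigenvector for
its largest eigenvalue (`exists_pos_perronVector`), so its star converges exactly when a scalar
geometric series is bounded (`starConverges_smul_iff`). Only here do the algebras differ: the
condition on the ratio `r` is `r ≤ 1` in max-times and `r < 1` in the nonnegative algebra. -/

theorem mulVec_mono_right (A : Matrix ι ι R) {x y : ι → R} (h : x ≤ y) : A *ᵥ x ≤ A *ᵥ y :=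
  fun _ => Finset.sum_le_sum fun j _ => mul_le_mul_of_nonneg_left (h j) zero_le

theorem mul_le_mulVec (A : Matrix ι ι R) (x : ι → R) (i j : ι) : A i j * x j ≤ (A *ᵥ x) i :=
  Finset.single_le_sum (f := fun j => A i j * x j) (fun _ _ => zero_le) (Finset.mem_univ j)

/-! ### Partial sums of the Kleene star. -/

variable [DecidableEq ι]

theorem sum_pow_mulVec_succ (A : Matrix ι ι R) (b : ι → R) (k : ℕ) :
    ∑ l ∈ Finset.range (k + 1), (A ^ l) *ᵥ b
      = A *ᵥ (∑ l ∈ Finset.range k, (A ^ l) *ᵥ b) + b := by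
  rw [Finset.sum_range_succ', mulVec_sum]
  simp [pow_succ', mulVec_mulVec]

theorem sum_pow_mulVec_mono (A : Matrix ι ι R) (b : ι → R) :
    Monotone fun k : ℕ => ∑ l ∈ Finset.range k, (A ^ l) *ᵥ b := by
  refine monotone_nat_of_le_succ fun k i => ?_
  simp only [Finset.sum_range_succ, Pi.add_apply]
  exact le_self_add

theorem sum_pow_mulVec_le {A : Matrix ι ι R} {b y : ι → R} (h : A *ᵥ y + b ≤ y) (k : ℕ) :
    ∑ l ∈ Finset.range k, (A ^ l) *ᵥ b ≤ y := by
  induction k with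
  | zero => intro i; simp
  | succ k ih =>
    rw [sum_pow_mulVec_succ]
    exact le_trans (fun i => add_le_add_left (mulVec_mono_right A ih i) _) h

theorem exists_isStarVec_of_bddAbove {A : Matrix ι ι R} {b y : ι → R}
    (h : ∀ k : ℕ, ∑ l ∈ Finset.range k, (A ^ l) *ᵥ b ≤ y) : ∃ x, IsStarVec A b x :=
  ⟨_, isLUB_csSup (Set.range_nonempty _) ⟨y, by rintro _ ⟨k, rfl⟩; exact h k⟩⟩

theorem exists_isStarVec {A : Matrix ι ι R} {b y : ι → R} (h : A *ᵥ y + b ≤ y) :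
    ∃ x, IsStarVec A b x :=
  exists_isStarVec_of_bddAbove (sum_pow_mulVec_le h)

theorem isStarVec_le {A : Matrix ι ι R} {b x y : ι → R} (hx : IsStarVec A b x)
    (h : A *ᵥ y + b ≤ y) : x ≤ y :=
  hx.2 (by rintro _ ⟨k, rfl⟩; exact sum_pow_mulVec_le h k)

theorem eq_pow_mulVec_add_sum {A : Matrix ι ι R} {b x : ι → R} (h : A *ᵥ x + b = x) (k : ℕ) :
    x = (A ^ k) *ᵥ x + ∑ l ∈ Finset.range k, (A ^ l) *ᵥ b := by
  induction k with
  | zero => simp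
  | succ k ih =>
    conv_lhs => rw [← h, ih]
    rw [sum_pow_mulVec_succ, mulVec_add, mulVec_mulVec, ← pow_succ', add_assoc]

theorem pow_mulVec_antitone {A : Matrix ι ι R} {x : ι → R} (h : A *ᵥ x ≤ x) :
    Antitone fun k : ℕ => (A ^ k) *ᵥ x := by
  refine antitone_nat_of_succ_le fun k => ?_
  simp only [pow_succ, ← mulVec_mulVec]
  exact mulVec_mono_right _ h

theorem starConverges_iff {B : Matrix ι ι R} :
    StarConverges B ↔ ∀ i j, ∃ c, ∀ k : ℕ, (∑ l ∈ Finset.range k, B ^ l) i j ≤ c := by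
  constructor
  · rintro ⟨S, hS⟩ i j
    exact ⟨S i j, fun k => (hS i j).1 ⟨k, rfl⟩⟩
  · intro h
    refine ⟨fun i j => sSup (Set.range fun k : ℕ => (∑ l ∈ Finset.range k, B ^ l) i j),
      fun i j => isLUB_csSup (Set.range_nonempty _) ?_⟩
    obtain ⟨c, hc⟩ := h i j
    exact ⟨c, by rintro _ ⟨k, rfl⟩; exact hc k⟩

theorem exists_bound_of_starConverges {B : Matrix ι ι R} (h : StarConverges B) (c : ι → R) :
    ∃ y, ∀ k : ℕ, ∑ l ∈ Finset.range k, (B ^ l) *ᵥ c ≤ y := by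
  obtain ⟨S, hS⟩ := h
  refine ⟨S *ᵥ c, fun k i => ?_⟩
  rw [← sum_mulVec]
  exact Finset.sum_le_sum fun j _ => mul_le_mul_of_nonneg_right ((hS i j).1 ⟨k, rfl⟩) zero_le

/-- A positive vector controls every matrix entry: `M i j * v j ≤ (M v) i`, and `v j` can be divided
out. -/
theorem starConverges_of_pos {B : Matrix ι ι R} {v y : ι → R} (hv : ∀ i, v i ≠ 0)
    (h : ∀ k : ℕ, ∑ l ∈ Finset.range k, (B ^ l) *ᵥ v ≤ y) : StarConverges B := by
  rw [starConverges_iff]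
  intro i j
  refine ⟨y i * (v j)⁻¹, fun k => ?_⟩
  have h1 := mul_le_mulVec (∑ l ∈ Finset.range k, B ^ l) v i j
  rw [sum_mulVec] at h1
  replace h1 := h1.trans (h k i)
  calc _ = (∑ l ∈ Finset.range k, B ^ l) i j * v j * (v j)⁻¹ := (mul_inv_cancel_right₀ (hv j) _).symm
    _ ≤ _ := mul_le_mul_of_nonneg_right h1 zero_le

/-! ### Access relations, supports and diagonal blocks. -/

theorem accesses_smul {A : Matrix ι ι R} {c : R} (hc : c ≠ 0) (i j : ι) :
    Accesses (c • A) i j ↔ Accesses A i j := by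
  simp [Accesses, pos_iff_ne_zero, hc]

/-- A vector which is nonzero at `j` and satisfies `A x ≤ μ x` is nonzero at every index that
accesses `j`. -/
theorem ne_zero_of_accesses {A : Matrix ι ι R} {x : ι → R} {μ : R} (h : A *ᵥ x ≤ μ • x)
    {i j : ι} (hij : Accesses A i j) (hj : x j ≠ 0) : x i ≠ 0 := by
  induction hij using Relation.ReflTransGen.head_induction_on with
  | refl => exact hj
  | head hac _ ih =>
    rename_i a c _
    intro h0
    have h1 := (mul_le_mulVec A x a c).trans (h a)
    rw [Pi.smul_apply, h0, smul_zero, nonpos_iff_eq_zero] at h1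
    exact mul_ne_zero hac.ne' ih h1

theorem exists_pow_mulVec_ne_zero {A : Matrix ι ι R} {b x : ι → R} (hx : IsStarVec A b x)
    {i : ι} (hi : x i ≠ 0) : ∃ m : ℕ, ((A ^ m) *ᵥ b) i ≠ 0 := by
  by_contra! h
  have hLUB : IsLUB _ (x i) := (isLUB_pi.1 hx) i
  refine hi (nonpos_iff_eq_zero.1 (hLUB.2 ?_))
  rintro _ ⟨_, ⟨k, rfl⟩, rfl⟩
  simp [Finset.sum_apply, h]

theorem exists_accesses_of_pow_mulVec_ne_zero {A : Matrix ι ι R} {b : ι → R} {m : ℕ} :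
    ∀ {i : ι}, ((A ^ m) *ᵥ b) i ≠ 0 → ∃ k, b k ≠ 0 ∧ Accesses A i k := by
  induction m with
  | zero => intro i hi; exact ⟨i, by simpa using hi, Relation.ReflTransGen.refl⟩
  | succ m ih =>
    intro i hi
    rw [pow_succ', ← mulVec_mulVec] at hi
    obtain ⟨j, _, hj⟩ := Finset.exists_ne_zero_of_sum_ne_zero hi
    obtain ⟨k, hk, hjk⟩ := ih (right_ne_zero_of_mul hj)
    exact ⟨k, hk, Relation.ReflTransGen.head (pos_iff_ne_zero.2 (left_ne_zero_of_mul hj)) hjk⟩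

theorem toSquareBlock_pow_le {s : ℕ} (A : Matrix ι ι R) (cls : ι → Fin s) (j : Fin s) (l : ℕ) :
    ∀ p q, (A.toSquareBlock cls j ^ l) p q ≤ (A ^ l) p q := by
  induction l with
  | zero => intro p q; by_cases h : p = q <;> simp [h, one_apply]
  | succ l ih =>
    intro p q
    rw [pow_succ', pow_succ', mul_apply, mul_apply]
    calc _ ≤ ∑ r : {a // cls a = j}, A p r * (A ^ l) r q :=
          Finset.sum_le_sum fun r _ => mul_le_mul_of_nonneg_left (ih r q) zero_le
      _ = ∑ r ∈ Finset.univ.filter (fun a => cls a = j), A p r * (A ^ l) r q :=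
          (Finset.sum_subtype _ (p := fun a => cls a = j) (by simp) fun r => A p r * (A ^ l) r q).symm
      _ ≤ _ := Finset.sum_le_sum_of_subset (Finset.filter_subset _ _)

/-- If `(A^m b) q ≠ 0`, then `(∑_{l<k} A^l) p q * (A^m b) q` is dominated by the terms `m, …, m+k-1`
of the series for `x p`, so the entry is bounded uniformly in `k`. Powers of the block lie below the
corresponding entries of powers of `A`. -/
theorem starConverges_toSquareBlock {s : ℕ} {A : Matrix ι ι R} {b x : ι → R}
    (hx : IsStarVec A b x) (cls : ι → Fin s) (j : Fin s) (hj : ∀ i, cls i = j → x i ≠ 0) :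
    StarConverges (A.toSquareBlock cls j) := by
  rw [starConverges_iff]
  intro p q
  obtain ⟨m, hm⟩ := exists_pow_mulVec_ne_zero hx (hj q q.2)
  refine ⟨x p * (((A ^ m) *ᵥ b) q)⁻¹, fun k => ?_⟩
  have h1 : (∑ l ∈ Finset.range k, A ^ l) p q * ((A ^ m) *ᵥ b) q ≤ x p := by
    have h2 := mul_le_mulVec (∑ l ∈ Finset.range k, A ^ l) ((A ^ m) *ᵥ b) p q
    have h3 := hx.1 ⟨m + k, rfl⟩ p
    simp only [Finset.sum_range_add, Finset.sum_apply] at h3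
    rw [sum_mulVec] at h2
    simp only [mulVec_mulVec, ← pow_add, add_comm _ m, Finset.sum_apply] at h2
    exact h2.trans (le_add_self.trans h3)
  have h2 : (∑ l ∈ Finset.range k, A.toSquareBlock cls j ^ l) p q
      ≤ (∑ l ∈ Finset.range k, A ^ l) p q := by
    simp only [sum_apply]
    exact Finset.sum_le_sum fun l _ => toSquareBlock_pow_le A cls j l p q
  calc _ ≤ (∑ l ∈ Finset.range k, A ^ l) p q := h2
    _ = (∑ l ∈ Finset.range k, A ^ l) p q * ((A ^ m) *ᵥ b) q * (((A ^ m) *ᵥ b) q)⁻¹ :=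
      (mul_inv_cancel_right₀ hm _).symm
    _ ≤ _ := mul_le_mul_of_nonneg_right h1 zero_le

/-! ### Limits, fixed points and supersolutions. -/

section Topology

variable [TopologicalSpace R] [OrderTopology R] [ContinuousAdd R] [ContinuousMul R]

theorem continuous_mulVec_right (A : Matrix ι ι R) : Continuous fun x : ι → R => A *ᵥ x :=
  continuous_const.matrix_mulVec continuous_id

theorem tendsto_of_isStarVec {A : Matrix ι ι R} {b x : ι → R} (hx : IsStarVec A b x) :
    Tendsto (fun k : ℕ => ∑ l ∈ Finset.range k, (A ^ l) *ᵥ b) atTop (𝓝 x) :=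
  tendsto_atTop_isLUB (sum_pow_mulVec_mono A b) hx

theorem isStarVec_fixed {A : Matrix ι ι R} {b x : ι → R} (hx : IsStarVec A b x) :
    A *ᵥ x + b = x := by
  have h := tendsto_of_isStarVec hx
  have h1 := (tendsto_add_atTop_iff_nat 1).2 h
  simp only [sum_pow_mulVec_succ] at h1
  exact tendsto_nhds_unique
    ((((continuous_mulVec_right A).tendsto x).comp h).add tendsto_const_nhds) h1

theorem exists_limit_pow_mulVec {A : Matrix ι ι R} {x : ι → R} (h : A *ᵥ x ≤ x) :
    ∃ v, Tendsto (fun k : ℕ => (A ^ k) *ᵥ x) atTop (𝓝 v) ∧ A *ᵥ v = v := by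
  have h1 : Tendsto (fun k : ℕ => (A ^ k) *ᵥ x) atTop (𝓝 (⨅ k : ℕ, (A ^ k) *ᵥ x)) :=
    tendsto_atTop_ciInf (pow_mulVec_antitone h)
      ⟨0, by rintro _ ⟨k, rfl⟩; exact fun i => zero_le⟩
  refine ⟨_, h1, ?_⟩
  have h2 := (tendsto_add_atTop_iff_nat 1).2 h1
  simp only [pow_succ', ← mulVec_mulVec] at h2
  exact tendsto_nhds_unique (((continuous_mulVec_right A).tendsto _).comp h1) h2

theorem exists_eq_star_add {A : Matrix ι ι R} {b x₀ x : ι → R} (hx₀ : IsStarVec A b x₀)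
    (hx : A *ᵥ x + b = x) : ∃ v, A *ᵥ v = v ∧ x = x₀ + v := by
  obtain ⟨v, hv, hfix⟩ := exists_limit_pow_mulVec (A := A) (x := x)
    (fun i => by conv_rhs => rw [← hx]
                 exact le_self_add)
  refine ⟨v, hfix, ?_⟩
  have h := hv.add (tendsto_of_isStarVec hx₀)
  simp only [← eq_pow_mulVec_add_sum hx] at h
  rw [add_comm]
  exact tendsto_nhds_unique tendsto_const_nhds h

/-- Since nothing cancels, a nonzero entry of `x` comes from a nonzero product along some path to
the support of `b`. Conversely, `x = A x + b` makes `x` nonzero on that support, and nonvanishing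
propagates backwards along arcs. -/
theorem isStarVec_ne_zero_iff {A : Matrix ι ι R} {b x : ι → R} (hx : IsStarVec A b x) (i : ι) :
    x i ≠ 0 ↔ ∃ k, b k ≠ 0 ∧ Accesses A i k := by
  constructor
  · intro hi
    obtain ⟨m, hm⟩ := exists_pow_mulVec_ne_zero hx hi
    exact exists_accesses_of_pow_mulVec_ne_zero hm
  · rintro ⟨k, hk, hik⟩
    have hfix := isStarVec_fixed hx
    have h1 : A *ᵥ x ≤ (1 : R) • x := fun i => by
      rw [one_smul]
      conv_rhs => rw [← hfix]
      exact le_self_add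
    refine ne_zero_of_accesses h1 hik fun h0 => hk ?_
    have h2 := congrFun hfix k
    rw [h0] at h2
    exact (add_eq_zero.1 h2).2

/-- If the stars of the diagonal blocks of a block triangular matrix converge for a set of classes
that carries `b` and is closed under access, then `A y + b ≤ y` has a solution. -/
theorem exists_supersolution {s : ℕ} {A : Matrix ι ι R} {b : ι → R} {cls : ι → Fin s}
    (lower : ∀ i j, cls i < cls j → A i j = 0) {J : Set (Fin s)}
    (hb : ∀ p, b p ≠ 0 → cls p ∈ J) (hA : ∀ p q, A p q ≠ 0 → cls q ∈ J → cls p ∈ J)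
    (hstar : ∀ j ∈ J, StarConverges (A.toSquareBlock cls j)) : ∃ y, A *ᵥ y + b ≤ y := by
  -- Induction over the first `m` classes: `y` is supported on them, within `J`, and the inequality
  -- is required only in their rows.
  suffices H : ∀ m : ℕ, ∃ y : ι → R, (∀ p, m ≤ (cls p : ℕ) → y p = 0) ∧
      (∀ p, (cls p : ℕ) < m → (A *ᵥ y + b) p ≤ y p) ∧ ∀ p, y p ≠ 0 → cls p ∈ J by
    obtain ⟨y, _, hy, _⟩ := H s
    exact ⟨y, fun p => hy p (cls p).2⟩
  intro m
  induction m with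
  | zero => exact ⟨0, by simp, by simp, by simp⟩
  | succ m ih =>
    obtain ⟨y, hy0, hy, hyJ⟩ := ih
    by_cases hm : ∃ j ∈ J, (j : ℕ) = m
    · obtain ⟨j, hjJ, hjm⟩ := hm
      -- On class `j` the new piece solves `z = A_jj z + (A y + b)_j`, the earlier classes entering
      -- through the right-hand side.
      obtain ⟨w, hw⟩ := exists_bound_of_starConverges (hstar j hjJ) fun p => (A *ᵥ y + b) p
      obtain ⟨z, hz⟩ := exists_isStarVec_of_bddAbove hw
      have hz := isStarVec_fixed hz
      set e : ι → R := fun p => if h : cls p = j then z ⟨p, h⟩ else 0 with he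
      have he0 : ∀ p, cls p ≠ j → e p = 0 := fun p hp => by simp [he, hp]
      have hej : ∀ p : {a // cls a = j}, e p = z p := fun p => by simp [he, p.2]
      -- Triangularity: extending `y` by `e` leaves the rows of earlier classes unchanged.
      have hAe : ∀ p, cls p < j → (A *ᵥ e) p = 0 := fun p hp =>
        Finset.sum_eq_zero fun q _ => by
          change A p q * e q = 0
          by_cases hq : cls q = j
          · rw [lower p q (by rwa [hq]), zero_mul]
          · rw [he0 q hq, mul_zero]
      have hAe' : ∀ p : {a // cls a = j}, (A *ᵥ e) p = (A.toSquareBlock cls j *ᵥ z) p := fun p => by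
        have h1 : ∀ q ∈ Finset.univ, q ∉ Finset.univ.filter (fun a => cls a = j) →
            A p q * e q = 0 := fun q _ hq => by
          rw [he0 q (by simpa using hq), mul_zero]
        refine (Finset.sum_subset (Finset.filter_subset _ _) h1).symm.trans ?_
        rw [Finset.sum_subtype _ (p := fun a => cls a = j) (by simp)]
        exact Finset.sum_congr rfl fun q _ => by rw [hej]; rfl
      refine ⟨y + e, fun p hp => ?_, fun p hp => ?_, fun p hp => ?_⟩
      · rw [Pi.add_apply, hy0 p (by omega), he0 p (by rintro rfl; omega), add_zero]
      · rw [mulVec_add]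
        rcases Nat.lt_succ_iff_lt_or_eq.1 hp with hp | hp
        · have h2 := hAe p (by rw [Fin.lt_def]; omega)
          have h3 := hy p hp
          simp only [Pi.add_apply] at h3 ⊢
          rw [h2, add_zero]
          exact h3.trans le_self_add
        · have hpj : cls p = j := Fin.ext (by omega)
          have h2 := hAe' ⟨p, hpj⟩
          have h3 := congrFun hz ⟨p, hpj⟩
          have h4 := hej ⟨p, hpj⟩
          simp only [Pi.add_apply] at h2 h3 h4 ⊢
          rw [h4, h2, hy0 p hp.ge, zero_add, ← h3]
          exact (by abel : _ = _).le
      · by_cases h : cls p = j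
        · rwa [h]
        · exact hyJ p (by simpa [he0 p h] using hp)
    · refine ⟨y, fun p hp => hy0 p (by omega), fun p hp => ?_, hyJ⟩
      rcases Nat.lt_succ_iff_lt_or_eq.1 hp with hp | hp
      · exact hy p hp
      · have hpJ : cls p ∉ J := fun h => hm ⟨_, h, hp⟩
        have h1 : b p = 0 := by_contra fun h => hpJ (hb p h)
        have h2 : (A *ᵥ y) p = 0 := Finset.sum_eq_zero fun q _ => by
          by_contra h
          exact hpJ (hA p q (left_ne_zero_of_mul h) (hyJ q (right_ne_zero_of_mul h)))
        rw [Pi.add_apply, h1, h2, add_zero]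
        exact zero_le

/-! ### Perron theory of irreducible matrices. -/

theorem exists_minimal_subeigenvalue [Nonempty ι] (B : Matrix ι ι R) :
    ∃ (x : ι → R) (μ : R), x ≠ 0 ∧ B *ᵥ x ≤ μ • x ∧
      ∀ (y : ι → R) (ν : R), y ≠ 0 → B *ᵥ y ≤ ν • y → μ ≤ ν := by
  set M : R := ∑ i, ∑ j, B i j with hM
  -- Normalizing some coordinate to `1` excludes `x = 0` while keeping the set compact. The bound
  -- `M` is feasible for the all-ones vector, so values above `M` are irrelevant to the minimum.
  set K : Set ((ι → R) × R) := (Set.Icc 0 1 ×ˢ Set.Icc 0 M) ∩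
    ({p | ∃ i, p.1 i = 1} ∩ {p | B *ᵥ p.1 ≤ p.2 • p.1}) with hK
  have hKc : IsCompact K := by
    refine (isCompact_Icc.prod isCompact_Icc).inter_right (IsClosed.inter ?_ ?_)
    · rw [Set.ofPred_exists]
      exact isClosed_iUnion_of_finite fun i => isClosed_eq (by fun_prop) continuous_const
    · exact isClosed_le ((continuous_mulVec_right B).comp continuous_fst)
        (continuous_snd.smul continuous_fst)
  have hKn : K.Nonempty := by
    obtain ⟨i⟩ := ‹Nonempty ι›
    refine ⟨(1, M), ⟨⟨⟨fun _ => zero_le, le_rfl⟩, ⟨zero_le, le_rfl⟩⟩, ⟨i, rfl⟩, fun p => ?_⟩⟩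
    simp only [mulVec, dotProduct, Pi.one_apply, mul_one, Pi.smul_apply, smul_eq_mul]
    exact Finset.single_le_sum (f := fun i => ∑ j, B i j) (fun _ _ => zero_le) (Finset.mem_univ p)
  obtain ⟨⟨x, μ⟩, hxK, hmin⟩ := hKc.exists_isMinOn hKn continuous_snd.continuousOn
  obtain ⟨⟨-, -, hμM⟩, ⟨i, hi⟩, hBx⟩ := hxK
  refine ⟨x, μ, fun h => by simp [h] at hi, hBx, fun y ν hy hBy => ?_⟩
  rcases le_total M ν with hν | hν
  · exact hμM.trans hν
  obtain ⟨q, hq⟩ := Finite.exists_max y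
  have hq0 : y q ≠ 0 := fun h => hy (funext fun p => nonpos_iff_eq_zero.1 (h ▸ hq p))
  refine hmin (a := ((y q)⁻¹ • y, ν)) ⟨⟨⟨fun _ => zero_le, fun p => ?_⟩, ⟨zero_le, hν⟩⟩,
    ⟨q, inv_mul_cancel₀ hq0⟩, fun p => ?_⟩
  · calc (y q)⁻¹ * y p ≤ (y q)⁻¹ * y q := mul_le_mul_of_nonneg_left (hq p) zero_le
      _ = 1 := inv_mul_cancel₀ hq0
  · dsimp only
    rw [mulVec_smul, smul_comm]
    exact mul_le_mul_of_nonneg_left (hBy p) zero_le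

variable [DenselyOrdered R]

/-- Take the least `μ` with `B x ≤ μ x` for some `x ≠ 0`. If `μ ≠ 0`, the iterates `(B/μ)^k x`
decrease to a fixed vector of `B/μ`. Were that vector zero, some iterate would be strictly below `x`
everywhere, leaving room to lower `μ`. Irreducibility makes the eigenvector positive. -/
theorem exists_pos_eigenvector [Nonempty ι] {B : Matrix ι ι R} (hB : IsIrred B) :
    ∃ (v : ι → R) (μ : R), (∀ i, v i ≠ 0) ∧ B *ᵥ v = μ • v := by
  obtain ⟨x, μ, hx0, hBx, hmin⟩ := exists_minimal_subeigenvalue B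
  have hpos : ∀ {y : ι → R} {ν : R}, y ≠ 0 → B *ᵥ y ≤ ν • y → ∀ i, y i ≠ 0 := by
    intro y ν hy h i
    obtain ⟨j, hj⟩ := Function.ne_iff.1 hy
    exact ne_zero_of_accesses h (hB i j) hj
  rcases eq_or_ne μ 0 with rfl | hμ
  · refine ⟨x, 0, hpos hx0 hBx, le_antisymm hBx ?_⟩
    rw [zero_smul]
    exact fun i => zero_le
  have hx := hpos hx0 hBx
  have hsub : ∀ {c : R} {y : ι → R}, c ≠ 0 → (c⁻¹ • B) *ᵥ y ≤ y → B *ᵥ y ≤ c • y := by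
    intro c y hc h i
    calc (B *ᵥ y) i = c * (((c⁻¹ • B) *ᵥ y) i) := by
          rw [smul_mulVec, Pi.smul_apply, smul_eq_mul, mul_inv_cancel_left₀ hc]
      _ ≤ c * y i := mul_le_mul_of_nonneg_left (h i) zero_le
  set C := μ⁻¹ • B with hC
  have hCx : C *ᵥ x ≤ x := fun i => by
    calc (C *ᵥ x) i = μ⁻¹ * (B *ᵥ x) i := by rw [hC, smul_mulVec]; rfl
      _ ≤ μ⁻¹ * (μ * x i) := mul_le_mul_of_nonneg_left (hBx i) zero_le
      _ = x i := inv_mul_cancel_left₀ hμ _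
  obtain ⟨v, hv, hCv⟩ := exists_limit_pow_mulVec hCx
  have hBv : B *ᵥ v = μ • v := by
    conv_rhs => rw [← hCv, hC, smul_mulVec, smul_smul, mul_inv_cancel₀ hμ, one_smul]
  refine ⟨v, μ, hpos ?_ hBv.le, hBv⟩
  rintro rfl
  have hev : ∀ᶠ k : ℕ in atTop, ∀ i, ((C ^ k) *ᵥ x) i < x i := eventually_all.2 fun i =>
    ((tendsto_pi_nhds.1 hv) i).eventually_lt_const (pos_iff_ne_zero.2 (hx i))
  obtain ⟨k, hk⟩ := hev.exists
  -- Strict inequality in finitely many coordinates survives a factor `t ^ k` with `t < 1` close to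
  -- `1`.
  have ht : ∀ᶠ t : R in 𝓝 1, ∀ i, ((C ^ k) *ᵥ x) i < t ^ k * x i := eventually_all.2 fun i => by
    have : Tendsto (fun t : R => t ^ k * x i) (𝓝 1) (𝓝 (1 ^ k * x i)) :=
      ((continuous_pow k).mul continuous_const).tendsto 1
    exact this.eventually_const_lt (by simpa using hk i)
  have : (𝓝[<] (1 : R)).NeBot := nhdsLT_neBot_of_exists_lt ⟨0, zero_lt_one⟩
  obtain ⟨t, htk, ht0, ht1⟩ := ((ht.filter_mono nhdsWithin_le_nhds).and
    (((lt_mem_nhds zero_lt_one).filter_mono nhdsWithin_le_nhds).and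
      (eventually_mem_nhdsWithin (a := (1 : R)) (s := Set.Iio 1)))).exists
  have hk0 : k ≠ 0 := by
    rintro rfl
    obtain ⟨i⟩ := ‹Nonempty ι›
    simpa using hk i
  obtain ⟨k, rfl⟩ := Nat.exists_eq_succ_of_ne_zero hk0
  set D := (t * μ)⁻¹ • B with hD
  have hDC : D = t⁻¹ • C := by rw [hD, hC, smul_smul, mul_inv]
  have hDx : (D ^ (k + 1)) *ᵥ x ≤ x := fun i => by
    rw [hDC, smul_pow, smul_mulVec, Pi.smul_apply, smul_eq_mul, inv_pow]
    calc _ ≤ (t ^ (k + 1))⁻¹ * (t ^ (k + 1) * x i) :=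
          mul_le_mul_of_nonneg_left (htk i).le zero_le
      _ = x i := inv_mul_cancel_left₀ (pow_ne_zero _ ht0.ne') _
  -- From `D^(k+1) x ≤ x`, summing one orbit segment gives `D y ≤ y`: applying `D` shifts the terms,
  -- and the last one falls below the first. Thus `t * μ < μ` is also feasible, against minimality.
  set y := ∑ l ∈ Finset.range (k + 1), (D ^ l) *ᵥ x with hy
  have hDy : D *ᵥ y ≤ y := by
    have h1 : D *ᵥ y = ∑ l ∈ Finset.range k, (D ^ (l + 1)) *ᵥ x + (D ^ (k + 1)) *ᵥ x := by
      rw [hy, mulVec_sum, Finset.sum_range_succ]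
      simp [pow_succ', mulVec_mulVec]
    rw [h1, hy, Finset.sum_range_succ', pow_zero, one_mulVec]
    exact fun i => add_le_add_right (hDx i) _
  have hy0 : y ≠ 0 := fun h => by
    rw [hy, Finset.sum_range_succ', pow_zero, one_mulVec] at h
    exact hx0 (funext fun i => (add_eq_zero.1 (congrFun h i)).2)
  have h2 := hmin y (t * μ) hy0 (hsub (mul_ne_zero ht0.ne' hμ) hDy)
  have h3 : μ * μ⁻¹ ≤ t * μ * μ⁻¹ := mul_le_mul_of_nonneg_right h2 zero_le
  rw [mul_inv_cancel_right₀ hμ, mul_inv_cancel₀ hμ] at h3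
  exact absurd ht1 (not_lt.2 h3)

/-- Take the smallest multiple `c • v` above `w`; the two agree at some `p`. Applying `B` and
comparing entries at `p` gives the bound. -/
theorem eigenvalue_le_of_pos {B : Matrix ι ι R} {v w : ι → R} {μ ν : R} (hv : ∀ i, v i ≠ 0)
    (hBv : B *ᵥ v = μ • v) (hw : w ≠ 0) (hBw : B *ᵥ w = ν • w) : ν ≤ μ := by
  obtain ⟨j, hj⟩ := Function.ne_iff.1 hw
  have : Nonempty ι := ⟨j⟩
  obtain ⟨p, hp⟩ := Finite.exists_max fun i => w i * (v i)⁻¹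
  set c := w p * (v p)⁻¹ with hc
  have hwc : w ≤ c • v := fun i => by
    calc w i = w i * (v i)⁻¹ * v i := (inv_mul_cancel_right₀ (hv i) _).symm
      _ ≤ c * v i := mul_le_mul_of_nonneg_right (hp i) zero_le
  have hcp : c * v p = w p := inv_mul_cancel_right₀ (hv p) _
  have hwp : w p ≠ 0 := fun h => by
    have h1 : c = 0 := by rw [hc, h, zero_mul]
    have h2 := hwc j
    rw [h1, zero_smul] at h2
    exact hj (nonpos_iff_eq_zero.1 h2)
  have h1 : ν * w p ≤ μ * w p := by
    calc ν * w p = (B *ᵥ w) p := by rw [hBw]; rfl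
      _ ≤ (B *ᵥ (c • v)) p := mulVec_mono_right B hwc p
      _ = c * (μ * v p) := by rw [mulVec_smul, hBv]; rfl
      _ = μ * w p := by rw [← hcp]; ring
  calc ν = ν * w p * (w p)⁻¹ := (mul_inv_cancel_right₀ hwp _).symm
    _ ≤ μ * w p * (w p)⁻¹ := mul_le_mul_of_nonneg_right h1 zero_le
    _ = μ := mul_inv_cancel_right₀ hwp _

theorem exists_pos_perronVector [Nonempty ι] {B : Matrix ι ι R} (hB : IsIrred B) :
    ∃ v : ι → R, (∀ i, v i ≠ 0) ∧ B *ᵥ v = perronRoot B • v := by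
  obtain ⟨v, μ, hv, hBv⟩ := exists_pos_eigenvector hB
  have hv0 : v ≠ 0 := fun h => by
    obtain ⟨i⟩ := ‹Nonempty ι›
    exact hv i (congrFun h i)
  have h : IsGreatest {lam | IsEigenvalue B lam} μ :=
    ⟨⟨v, hv0, hBv⟩, by rintro ν ⟨w, hw, hBw⟩; exact eigenvalue_le_of_pos hv hBv hw hBw⟩
  exact ⟨v, hv, by rw [perronRoot, h.csSup_eq, hBv]⟩

/-- On a positive Perron vector the partial sums of the star act as the scalar geometric sums, and
boundedness on a positive vector is equivalent to convergence of the star. -/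
theorem starConverges_smul_iff [Nonempty ι] {B : Matrix ι ι R} (hB : IsIrred B) (c : R) :
    StarConverges (c • B) ↔
      BddAbove (Set.range fun k : ℕ => ∑ l ∈ Finset.range k, (c * perronRoot B) ^ l) := by
  obtain ⟨v, hv, hBv⟩ := exists_pos_perronVector hB
  have hpow : ∀ l : ℕ, ((c • B) ^ l) *ᵥ v = (c * perronRoot B) ^ l • v := by
    intro l
    induction l with
    | zero => simp
    | succ l ih =>
      rw [pow_succ', ← mulVec_mulVec, ih, mulVec_smul, smul_mulVec, hBv, smul_smul, smul_smul,
        pow_succ, mul_assoc]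
  constructor
  · intro h
    obtain ⟨y, hy⟩ := exists_bound_of_starConverges h v
    obtain ⟨i⟩ := ‹Nonempty ι›
    refine ⟨y i * (v i)⁻¹, ?_⟩
    rintro _ ⟨k, rfl⟩
    have h1 := hy k
    simp only [hpow, ← Finset.sum_smul] at h1
    calc _ = (∑ l ∈ Finset.range k, (c * perronRoot B) ^ l) * v i * (v i)⁻¹ :=
          (mul_inv_cancel_right₀ (hv i) _).symm
      _ ≤ _ := mul_le_mul_of_nonneg_right (h1 i) zero_le
  · rintro ⟨M, hM⟩
    refine starConverges_of_pos (y := M • v) hv fun k => ?_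
    simp only [hpow, ← Finset.sum_smul]
    exact fun i => mul_le_mul_of_nonneg_right (hM ⟨k, rfl⟩) zero_le

end Topology

end Matrix
namespace Matrix

/-! ### The system `lam x = A x + b` in either algebra. -/

section Generic

variable {R : Type*} [Semifield R] [ConditionallyCompleteLinearOrderBot R]
  [CanonicallyOrderedAdd R] [IsOrderedRing R]
  [TopologicalSpace R] [OrderTopology R] [ContinuousAdd R] [ContinuousMul R]

theorem isSolution_iff_fixed {ι : Type*} [Fintype ι] {A : Matrix ι ι R} {b x : ι → R} {lam : R}
    (h : lam ≠ 0) : IsSolution A b lam x ↔ (lam⁻¹ • A) *ᵥ x + lam⁻¹ • b = x := by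
  rw [IsSolution, smul_mulVec, ← smul_add, inv_smul_eq_iff₀ h, eq_comm]

theorem mulVec_eq_smul_iff {ι : Type*} [Fintype ι] {A : Matrix ι ι R} {v : ι → R} {lam : R}
    (h : lam ≠ 0) : A *ᵥ v = lam • v ↔ (lam⁻¹ • A) *ᵥ v = v := by
  rw [smul_mulVec, inv_smul_eq_iff₀ h]

theorem isStarVec_zero_iff {ι : Type*} [Fintype ι] [DecidableEq ι] {A : Matrix ι ι R}
    {x : ι → R} : IsStarVec A 0 x ↔ x = 0 := by
  have h : (Set.range fun k : ℕ => ∑ l ∈ Finset.range k, (A ^ l) *ᵥ (0 : ι → R)) = {0} := by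
    simp
  rw [IsStarVec, h]
  exact ⟨fun hx => hx.unique isLUB_singleton, fun hx => hx ▸ isLUB_singleton⟩

/-- Irreducibility of the diagonal block lets access by one index of a class pass to all of them. -/
theorem exists_accesses_iff_mem_accessClasses {n s : ℕ} {A : Matrix (Fin n) (Fin n) R}
    {cls : Fin n → Fin s} (hA : IsFNF A cls) (b : Fin n → R) (i : Fin n) :
    (∃ k, b k ≠ 0 ∧ Accesses A i k) ↔ cls i ∈ accessClasses A cls b := by
  simp only [accessClasses, Finset.mem_filter, Finset.mem_univ, true_and]
  constructor
  · rintro ⟨k, hk, hik⟩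
    exact ⟨i, k, rfl, hk, hik⟩
  · rintro ⟨i', k, hi', hk, hik⟩
    refine ⟨k, hk, Relation.ReflTransGen.trans ?_ hik⟩
    exact Relation.ReflTransGen.lift (p := fun k l => 0 < A k l) Subtype.val (fun _ _ h => h) _ _
      (hA.irred (cls i) ⟨i, rfl⟩ ⟨i', hi'⟩)

theorem accessClasses_zero {n s : ℕ} (A : Matrix (Fin n) (Fin n) R) (cls : Fin n → Fin s) :
    accessClasses A cls 0 = ∅ := by
  simp [accessClasses]

variable {n s : ℕ} {A : Matrix (Fin n) (Fin n) R} {cls : Fin n → Fin s} {b : Fin n → R} {lam : R}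

theorem isStarVec_smul_ne_zero_iff (hA : IsFNF A cls) (hlam : lam ≠ 0 ∨ b = 0) {x₀ : Fin n → R}
    (hx₀ : IsStarVec (lam⁻¹ • A) (lam⁻¹ • b) x₀) (i : Fin n) :
    x₀ i ≠ 0 ↔ cls i ∈ accessClasses A cls b := by
  by_cases hb : b = 0
  · subst hb
    rw [smul_zero, isStarVec_zero_iff] at hx₀
    simp [accessClasses_zero, hx₀]
  have h0 : lam⁻¹ ≠ 0 := inv_ne_zero (hlam.resolve_right hb)
  rw [isStarVec_ne_zero_iff hx₀, ← exists_accesses_iff_mem_accessClasses hA]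
  simp only [accesses_smul h0, Pi.smul_apply, smul_eq_mul, mul_ne_zero_iff, h0, ne_eq,
    not_false_eq_true, true_and]

theorem isLeast_of_isStarVec (hlam : lam ≠ 0 ∨ b = 0) {x₀ : Fin n → R}
    (hx₀ : IsStarVec (lam⁻¹ • A) (lam⁻¹ • b) x₀) : IsLeast {y | IsSolution A b lam y} x₀ := by
  by_cases h0 : lam = 0
  · obtain rfl := hlam.resolve_left (not_not.2 h0)
    rw [smul_zero, isStarVec_zero_iff] at hx₀
    subst hx₀
    exact ⟨by simp [IsSolution], fun y _ i => zero_le⟩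
  · exact ⟨(isSolution_iff_fixed h0).2 (isStarVec_fixed hx₀),
      fun y hy => isStarVec_le hx₀ ((isSolution_iff_fixed h0).1 hy).le⟩

theorem exists_eq_add_of_isSolution (hlam : lam ≠ 0 ∨ b = 0) {x₀ : Fin n → R}
    (hx₀ : IsStarVec (lam⁻¹ • A) (lam⁻¹ • b) x₀) {x : Fin n → R} (hx : IsSolution A b lam x) :
    ∃ v, A *ᵥ v = lam • v ∧ x = x₀ + v := by
  by_cases h0 : lam = 0
  · obtain rfl := hlam.resolve_left (not_not.2 h0)
    rw [smul_zero, isStarVec_zero_iff] at hx₀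
    rw [IsSolution, add_zero] at hx
    exact ⟨x, hx.symm, by rw [hx₀, zero_add]⟩
  · obtain ⟨v, hv, hxv⟩ := exists_eq_star_add hx₀ ((isSolution_iff_fixed h0).1 hx)
    exact ⟨v, (mulVec_eq_smul_iff h0).2 hv, hxv⟩

theorem unique_solution_iff [NoMaxOrder R] (hlam : lam ≠ 0 ∨ b = 0) {x₀ : Fin n → R}
    (hx₀ : IsStarVec (lam⁻¹ • A) (lam⁻¹ • b) x₀) :
    (∀ x, IsSolution A b lam x → x = x₀) ↔ ¬ IsEigenvalue A lam := by
  constructor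
  · rintro h ⟨v, hv, hAv⟩
    obtain ⟨i, hi⟩ := Function.ne_iff.1 hv
    obtain ⟨u, hu⟩ := exists_gt (x₀ i)
    have hsol : lam • x₀ = A *ᵥ x₀ + b := (isLeast_of_isStarVec hlam hx₀).1
    -- Adding `v` itself might be absorbed by the maximum; the scaling makes its entry at `i` equal
    -- to `u > x₀ i`, so the sum differs from `x₀`.
    have h1 : IsSolution A b lam (x₀ + (u * (v i)⁻¹) • v) := by
      rw [IsSolution, mulVec_add, mulVec_smul, hAv, smul_add, hsol, smul_comm lam]
      abel
    have h2 := congrFun (h _ h1) i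
    rw [Pi.add_apply, Pi.smul_apply, smul_eq_mul, inv_mul_cancel_right₀ hi] at h2
    exact absurd h2 (hu.trans_le le_add_self).ne'
  · intro h x hx
    obtain ⟨v, hv, rfl⟩ := exists_eq_add_of_isSolution hlam hx₀ hx
    by_contra hne
    exact h ⟨v, fun hv0 => hne (by rw [hv0, add_zero]), hv⟩

theorem exists_isStarVec_iff (hA : IsFNF A cls) (hlam : lam ≠ 0 ∨ b = 0) :
    (∃ x, IsStarVec (lam⁻¹ • A) (lam⁻¹ • b) x) ↔
      ∀ j ∈ accessClasses A cls b, StarConverges (lam⁻¹ • A.toSquareBlock cls j) := by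
  constructor
  · rintro ⟨x, hx⟩ j hj
    exact starConverges_toSquareBlock hx cls j fun i hi =>
      (isStarVec_smul_ne_zero_iff hA hlam hx i).2 (hi ▸ hj)
  · intro h
    by_cases hb : b = 0
    · exact ⟨0, by rw [hb, smul_zero, isStarVec_zero_iff]⟩
    have hmem := exists_accesses_iff_mem_accessClasses hA b
    obtain ⟨y, hy⟩ := exists_supersolution (A := lam⁻¹ • A) (b := lam⁻¹ • b) (cls := cls)
      (J := {j | j ∈ accessClasses A cls b})
      (fun i j hij => by rw [smul_apply, hA.lower i j hij, smul_zero])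
      (fun p hp => (hmem p).1 ⟨p, right_ne_zero_of_mul hp, Relation.ReflTransGen.refl⟩)
      (fun p q hpq hq => by
        obtain ⟨k, hk, hqk⟩ := (hmem q).2 hq
        exact (hmem p).1 ⟨k, hk,
          Relation.ReflTransGen.head (pos_iff_ne_zero.2 (right_ne_zero_of_mul hpq)) hqk⟩)
      h
    exact exists_isStarVec hy

/-- The equivalences common to both algebras; in the last condition convergence of the stars is
expressed by the geometric series of the Perron roots. -/
theorem tfae_solvability [DenselyOrdered R] (hA : IsFNF A cls) (hlam : lam ≠ 0 ∨ b = 0) :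
    [ ∃ x, IsSolution A b lam x,
      ∃ x, IsLeast {y | IsSolution A b lam y} x,
      ∃ x, IsStarVec (lam⁻¹ • A) (lam⁻¹ • b) x,
      ∀ j ∈ accessClasses A cls b, StarConverges (lam⁻¹ • A.toSquareBlock cls j),
      ∀ j ∈ accessClasses A cls b, BddAbove (Set.range fun k : ℕ =>
        ∑ l ∈ Finset.range k, (lam⁻¹ * perronRoot (A.toSquareBlock cls j)) ^ l) ].TFAE := by
  tfae_have 1 → 3 := by
    rintro ⟨x, hx⟩
    by_cases h0 : lam = 0
    · exact ⟨0, by rw [hlam.resolve_left (not_not.2 h0), smul_zero, isStarVec_zero_iff]⟩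
    · exact exists_isStarVec ((isSolution_iff_fixed h0).1 hx).le
  tfae_have 3 → 2 := fun ⟨x, hx⟩ => ⟨x, isLeast_of_isStarVec hlam hx⟩
  tfae_have 2 → 1 := fun ⟨x, hx⟩ => ⟨x, hx.1⟩
  tfae_have 3 ↔ 4 := exists_isStarVec_iff hA hlam
  tfae_have 4 ↔ 5 := by
    refine forall₂_congr fun j _ => ?_
    obtain ⟨i, hi⟩ := hA.surjective j
    have : Nonempty {a // cls a = j} := ⟨⟨i, hi⟩⟩
    exact starConverges_smul_iff (hA.irred j) _
  tfae_finish

end Generic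

end Matrix

/-! ### Geometric sums in the two algebras. -/

namespace NNReal

theorem bddAbove_geom_sum_iff (r : ℝ≥0) :
    BddAbove (Set.range fun k : ℕ => ∑ l ∈ Finset.range k, r ^ l) ↔ r < 1 := by
  constructor
  · rintro ⟨M, hM⟩
    by_contra! h
    obtain ⟨k, hk⟩ := exists_nat_gt M
    refine absurd (hM ⟨k, rfl⟩) (not_le.2 (hk.trans_le ?_))
    calc (k : ℝ≥0) = ∑ l ∈ Finset.range k, 1 := by simp
      _ ≤ _ := Finset.sum_le_sum fun l _ => one_le_pow₀ h
  · intro h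
    refine ⟨(1 - r)⁻¹, ?_⟩
    rintro _ ⟨k, rfl⟩
    exact sum_le_hasSum _ (fun _ _ => zero_le) (NNReal.hasSum_geometric h)

end NNReal

namespace MaxTimes

instance : CanonicallyOrderedAdd MaxTimes where
  exists_add_of_le {_ b} h := ⟨b, (max_eq_right h).symm⟩
  le_self_add := le_max_left
  le_add_self a b := le_max_right b a

instance : IsOrderedRing MaxTimes where
  add_le_add_left _ _ h c := max_le_max_right c h
  zero_le_one := bot_le
  mul_le_mul_of_nonneg_left _ _ _ _ h := mul_le_mul_of_nonneg_left (α := ℝ≥0) h bot_le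
  mul_le_mul_of_nonneg_right _ _ _ _ h := mul_le_mul_of_nonneg_right (α := ℝ≥0) h bot_le

noncomputable instance : TopologicalSpace MaxTimes := inferInstanceAs (TopologicalSpace ℝ≥0)

instance : OrderTopology MaxTimes := inferInstanceAs (OrderTopology ℝ≥0)

instance : ContinuousAdd MaxTimes := ⟨continuous_max (α := ℝ≥0)⟩

instance : ContinuousMul MaxTimes := ⟨continuous_mul (M := ℝ≥0)⟩

instance : DenselyOrdered MaxTimes := inferInstanceAs (DenselyOrdered ℝ≥0)

instance : NoMaxOrder MaxTimes := inferInstanceAs (NoMaxOrder ℝ≥0)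

theorem bddAbove_geom_sum_iff (r : MaxTimes) :
    BddAbove (Set.range fun k : ℕ => ∑ l ∈ Finset.range k, r ^ l) ↔ r ≤ 1 := by
  constructor
  · rintro ⟨M, hM⟩
    by_contra! h
    have h1 : @LT.lt ℝ≥0 _ 1 r := h
    obtain ⟨k, hk⟩ := pow_unbounded_of_one_lt (R := ℝ≥0) M h1
    refine absurd (hM ⟨k + 1, rfl⟩) (not_le.2 (lt_of_lt_of_le hk ?_))
    exact Finset.single_le_sum (f := fun l => r ^ l) (fun _ _ => zero_le)
      (Finset.self_mem_range_succ k)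
  · intro h
    refine ⟨1, ?_⟩
    rintro _ ⟨k, rfl⟩
    dsimp only
    induction k with
    | zero => exact bot_le
    | succ k ih =>
      rw [Finset.sum_range_succ]
      exact max_le ih (pow_le_one₀ bot_le h)

end MaxTimes

theorem theorem3p5 {n s : ℕ} (cls : Fin n → Fin s) :
    -- max-times algebra
    (∀ (A : Matrix (Fin n) (Fin n) MaxTimes) (b : Fin n → MaxTimes) (lam : MaxTimes),
      IsFNF A cls → (0 < lam ∨ b = 0) →
      [ ∃ x, IsSolution A b lam x,
        ∃ x, IsLeast {y | IsSolution A b lam y} x,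
        ∃ x, IsStarVec (lam⁻¹ • A) (lam⁻¹ • b) x,
        ∀ j ∈ accessClasses A cls b, StarConverges (lam⁻¹ • A.toSquareBlock cls j),
        rhoBar A cls b ≤ lam ].TFAE ∧
      ∀ x₀, IsStarVec (lam⁻¹ • A) (lam⁻¹ • b) x₀ →
        IsLeast {y | IsSolution A b lam y} x₀ ∧
        (∀ i, x₀ i ≠ 0 ↔ cls i ∈ accessClasses A cls b) ∧
        ((∀ x, IsSolution A b lam x → x = x₀) ↔ ¬ IsEigenvalue A lam) ∧
        (∀ x, IsSolution A b lam x → ∃ v, A *ᵥ v = lam • v ∧ x = x₀ + v)) ∧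
    -- nonnegative linear algebra
    (∀ (A : Matrix (Fin n) (Fin n) ℝ≥0) (b : Fin n → ℝ≥0) (lam : ℝ≥0),
      IsFNF A cls → (0 < lam ∨ b = 0) →
      [ ∃ x, IsSolution A b lam x,
        ∃ x, IsLeast {y | IsSolution A b lam y} x,
        ∃ x, IsStarVec (lam⁻¹ • A) (lam⁻¹ • b) x,
        ∀ j ∈ accessClasses A cls b, StarConverges (lam⁻¹ • A.toSquareBlock cls j),
        (b = 0 ∨ rhoBar A cls b < lam) ].TFAE ∧
      ∀ x₀, IsStarVec (lam⁻¹ • A) (lam⁻¹ • b) x₀ →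
        IsLeast {y | IsSolution A b lam y} x₀ ∧
        (∀ i, x₀ i ≠ 0 ↔ cls i ∈ accessClasses A cls b) ∧
        ((∀ x, IsSolution A b lam x → x = x₀) ↔ ¬ IsEigenvalue A lam) ∧
        (∀ x, IsSolution A b lam x → ∃ v, A *ᵥ v = lam • v ∧ x = x₀ + v)) := by
  refine ⟨fun A b lam hA hlam => ?_, fun A b lam hA hlam => ?_⟩ <;>
    replace hlam := hlam.imp_left ne_of_gt <;>
    refine ⟨?_, fun x₀ hx₀ => ⟨Matrix.isLeast_of_isStarVec hlam hx₀,
      Matrix.isStarVec_smul_ne_zero_iff hA hlam hx₀, Matrix.unique_solution_iff hlam hx₀,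
      fun x hx => Matrix.exists_eq_add_of_isSolution hlam hx₀ hx⟩⟩
  -- Only the last condition remains to be matched with bounded geometric sums. For `b = 0` no class
  -- accesses the support, so both sides hold.
  · convert Matrix.tfae_solvability hA hlam using 6
    by_cases hb : b = 0
    · simp [hb, rhoBar, Matrix.accessClasses_zero]
    have h0 := hlam.resolve_right hb
    rw [rhoBar, Finset.sup_le_iff]
    refine forall₂_congr fun j _ => ?_
    rw [MaxTimes.bddAbove_geom_sum_iff]
    exact (inv_mul_le_one₀ (G₀ := ℝ≥0) (pos_iff_ne_zero.2 h0)).symm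
  · convert Matrix.tfae_solvability hA hlam using 6
    by_cases hb : b = 0
    · simp [hb, Matrix.accessClasses_zero]
    have h0 := hlam.resolve_right hb
    -- The strict bound on a supremum that may be over the empty set, with value `0`, needs `0 <
    -- lam`.
    rw [rhoBar, Finset.sup_lt_iff (pos_iff_ne_zero.2 h0), or_iff_right hb]
    refine forall₂_congr fun j _ => ?_
    rw [NNReal.bddAbove_geom_sum_iff]
    exact (inv_mul_lt_one₀ (pos_iff_ne_zero.2 h0)).symm
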